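/- **Setting.** There are $n$ suppliers. In a period with context $\theta=(\theta_1,\dots,\theta_n)$ supplier $i$ has cost function $c_i(\cdot;\phi_i,\theta_i)$ on $[0,\infty)$, where $\phi_i$ is fixed and unknown to the operator. For every context in the set $\mathcal S$ of admissible contexts the cost functions vanish at $0$, are increasing, continuously differentiable, $\mu$-strongly convex ($\mu>0$), and their derivatives are $\beta$-Lipschitz on the range $[0,\bar x]$ of productions. At price $p$, supplier $i$ produces $x_i^*(p;\theta)=\arg\max_{x\ge 0}\,(px-c_i(x;\phi_i,\theta_i))$, and $x^*(p;\theta)=\sum_i x_i^*(p;\theta)$; it is assumed that $x^*(p;\theta)\le\bar x$ for $p\in[0,1]$, $\theta\in\mathcal S$. Demands lie in $[\underline d,\bar d]$ with $\underline d>0$. The equilibrium price for $(\theta,d)$ is the optimal dual variable $p^*$ of the constraint $\sum_i x_i=d$ in $\min_{x\ge 0}\sum_i c_i(x_i;\phi_i,\theta_i)$; prices are normalized so that $p^*\in[0,1]$ for all $\theta\in\mathcal S$, $d\in[\underline d,\bar d]$. For a period with context $\theta_t$, demand $d_t$ and equilibrium price $p_t^*$ put $$u_t(p)=\bigl(d_t-x^*(p;\theta_t)\bigr)_+,\qquad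 \pi_t(p)=\sum_i\bigl(p\,x_i^*(p;\theta_t)-p_t^*x_i^*(p_t^*;\theta_t)\bigr),$$ $$\kappa_t(p)=\sum_i\bigl(c_i(x_i^*(p;\theta_t);\phi_i,\theta_{it})-c_i(x_i^*(p_t^*;\theta_t);\phi_i,\theta_{it})\bigr),$$ and $U_T=\sum_{t\le T}u_t(p_t)$ (unmet demand), $P_T=\sum_{t\le T}\pi_t(p_t)$ (payment regret), $C_T=\sum_{t\le T}\kappa_t(p_t)$ (cost regret). **Oracle.** Let $\mathcal F$ be a class of functions $\mathcal S\times[0,1]\to[0,\bar x]$. An online regression oracle for $\mathcal F$ with error bound $\mathrm{Est}_{sq}(T)$ produces, from the past pairs $(a_1,b_1),\dots,(a_{t-1},b_{t-1})$, an estimator $\hat f_t:\mathcal S\times[0,1]\to[0,\bar x]$ such that for every sequence $(a_t,b_t)_{t\le T}$ in $(\mathcal S\times[0,1])\times[0,\bar x]$ $$\sum_{t=1}^T(\hat f_t(a_t)-b_t)^2-\inf_{f\in\mathcal F}\sum_{t=1}^T(f(a_t)-b_t)^2\le \mathrm{Est}_{sq}(T).$$ $\mathcal F$ is $\varepsilon$-misspecified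 with respect to $x^*$ ($\varepsilon\ge0$) if some $f\in\mathcal F$ satisfies $|f(\theta,p)-x^*(p;\theta)|\le\varepsilon$ for all $(\theta,p)\in\mathcal S\times[0,1]$. **Algorithm.** Fix $K\ge 2$, the grid $p_i=(i-1)/(K-1)$, $i=1,\dots,K$, and $\gamma>0$. In period $t$ the algorithm has the oracle's estimator $\hat f_t$, receives $(\theta_t,d_t)$, samples the price from $$\Delta_t(p_i)=\frac{1}{\lambda_t+2\gamma\bigl(|\hat f_t(\theta_t,p_i)-d_t|-\min_j|\hat f_t(\theta_t,p_j)-d_t|\bigr)},$$ where $\lambda_t\in(0,K]$ makes $\Delta_t$ a probability distribution, observes $x_t=x^*(p_t;\theta_t)$, and updates the oracle with $((\theta_t,p_t),x_t)$. **Theorem.** There is a constant $C>0$, depending only on $n,\mu,\beta,\bar x,\underline d,\bar d$, such that the following holds for all $T\ge1$, $K\ge2$, $\varepsilon\ge 0$, $\delta\in(0,1)$. Suppose $\mathcal F$ is $\varepsilon$-misspecified with respect to $x^*$, and run the algorithm with an online regression oracle for $\mathcal F$ and $\gamma=\sqrt{KT/(\mathrm{Est}_{sq}(T)+\varepsilon^2T+\log(1/\delta))}$.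 Then for any sequence of contexts $\theta_t\in\mathcal S$ and demands $d_t\in[\underline d,\bar d]$ (which may be chosen adaptively, as functions of the past periods), with probability at least $1-\delta$ over the history of the algorithm, simultaneously $$\sum_{t=1}^T\mathbb E_{p\sim\Delta_t}[u_t(p)\mid\mathcal H_{t-1}],\quad \sum_{t=1}^T\mathbb E_{p\sim\Delta_t}[\pi_t(p)\mid\mathcal H_{t-1}],\quad \sum_{t=1}^T\mathbb E_{p\sim\Delta_t}[\kappa_t(p)\mid\mathcal H_{t-1}]$$ are each at most $$C\Bigl(\sqrt{KT\,\mathrm{Est}_{sq}(T)}+\varepsilon\sqrt K\,T+\frac TK+\sqrt{KT\log(1/\delta)}\Bigr).$$ These three sums are the quantities $\mathbb E_{p_t\sim\Delta_t,\,t\in[T]}$ of $U_T$, $P_T$ and $C_T$. -/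

import Mathlib

universe u v w

noncomputable section

namespace EqPricing

/-! ### One period of the market -/

/-- Standing assumptions on a cost function `c : [0,∞) → [0,∞)`: normalized, increasing,
continuously differentiable, `μ`-strongly convex, and `β`-Lipschitz smooth on the range `[0, xbar]`
of production levels. Values of `c` at negative arguments play no role. -/
structure IsCost (μ β xbar : ℝ) (c : ℝ → ℝ) : Prop where
  zero : c 0 = 0
  mono : MonotoneOn c (Set.Ici 0)
  contDiff : ContDiffOn ℝ 1 c (Set.Ici 0)
  strongConvex : StrongConvexOn (Set.Ici 0) μ c
  smooth : ∀ x ∈ Set.Icc 0 xbar, ∀ y ∈ Set.Icc 0 xbar,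
    |derivWithin c (Set.Ici 0) x - derivWithin c (Set.Ici 0) y| ≤ β * |x - y|

/-- The production of a supplier with cost `c` at price `p`: a maximizer of `p * x - c x` over
`x ≥ 0` (it exists and is unique for strongly convex `c`). -/
def supply (c : ℝ → ℝ) (p : ℝ) : ℝ :=
  Classical.epsilon fun x => x ∈ Set.Ici (0 : ℝ) ∧ IsMaxOn (fun y => p * y - c y) (Set.Ici 0) x

/-- Total production of the suppliers with costs `C 0, …, C (n-1)` at price `p`. -/
def totalSupply {n : ℕ} (C : Fin n → ℝ → ℝ) (p : ℝ) : ℝ := ∑ i, supply (C i) p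

/-- Lagrange dual function of the problem: minimize `∑ i, C i (x i)` over `x ≥ 0` subject to
`∑ i, x i = d`; the price `p` is the dual variable of the market clearing constraint. -/
def dualValue {n : ℕ} (C : Fin n → ℝ → ℝ) (d p : ℝ) : ℝ :=
  p * d + ∑ i, ⨅ x : Set.Ici (0 : ℝ), (C i x - p * x)

/-- `p` is an optimal dual variable of the market clearing constraint. -/
def IsDualOptimal {n : ℕ} (C : Fin n → ℝ → ℝ) (d p : ℝ) : Prop :=
  ∀ q : ℝ, dualValue C d q ≤ dualValue C d p

/-- The equilibrium price: the optimal dual variable of the market clearing constraint. -/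
def eqPrice {n : ℕ} (C : Fin n → ℝ → ℝ) (d : ℝ) : ℝ :=
  Classical.epsilon (IsDualOptimal C d)

/-- Unmet demand of one period with costs `C`, demand `d` and posted price `p`. -/
def unmetDemand {n : ℕ} (C : Fin n → ℝ → ℝ) (d p : ℝ) : ℝ :=
  max (d - ∑ i, supply (C i) p) 0

/-- Payment regret of one period. -/
def paymentRegret {n : ℕ} (C : Fin n → ℝ → ℝ) (d p : ℝ) : ℝ :=
  ∑ i, (p * supply (C i) p - eqPrice C d * supply (C i) (eqPrice C d))

/-- Cost regret of one period. -/
def costRegret {n : ℕ} (C : Fin n → ℝ → ℝ) (d p : ℝ) : ℝ :=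
  ∑ i, (C i (supply (C i) p) - C i (supply (C i) (eqPrice C d)))

/-! ### Markets with contexts -/

/-- A market of `n` suppliers. The cost of supplier `i` is `cost i (φ i) θᵢ`, with a private
time-invariant component `φ i` and a context component `θᵢ`; the joint context
`θ = (θ₁, …, θₙ)` ranges over the set `contexts`. -/
structure Market {n : ℕ} (Φ : Fin n → Type u) (Θ : Fin n → Type v) where
  cost : (i : Fin n) → Φ i → Θ i → ℝ → ℝ
  φ : (i : Fin n) → Φ i
  contexts : Set ((i : Fin n) → Θ i)

variable {n : ℕ} {Φ : Fin n → Type u} {Θ : Fin n → Type v}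

/-- The profile of cost functions in context `θ`. -/
def Market.costs (M : Market Φ Θ) (θ : (i : Fin n) → Θ i) : Fin n → ℝ → ℝ :=
  fun i => M.cost i (M.φ i) (θ i)

/-- The production function `x*`, as a function of the context-price pair. -/
def Market.production (M : Market Φ Θ) (a : ((i : Fin n) → Θ i) × ℝ) : ℝ :=
  totalSupply (M.costs a.1) a.2

/-- The domain of the regression problem: contexts and prices in `[0, 1]`. -/
def Market.inputs (M : Market Φ Θ) : Set (((i : Fin n) → Θ i) × ℝ) :=
  M.contexts ×ˢ Set.Icc 0 1

/-- Standing assumptions on the market, uniform over contexts: costs as in `IsCost`, total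
production at prices in `[0, 1]` at most `xbar`, and prices normalized so that for all demands in
`[dlo, dhi]` the equilibrium price lies in `[0, 1]`. -/
structure Market.IsRegular (M : Market Φ Θ) (μ β xbar dlo dhi : ℝ) : Prop where
  isCost : ∀ θ ∈ M.contexts, ∀ i, IsCost μ β xbar (M.costs θ i)
  production_le : ∀ a ∈ M.inputs, M.production a ≤ xbar
  price_normalized : ∀ θ ∈ M.contexts, ∀ d ∈ Set.Icc dlo dhi,
    ∃ p ∈ Set.Icc (0 : ℝ) 1, IsDualOptimal (M.costs θ) d p

/-! ### Online regression oracles -/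

/-- A regression procedure: maps the past input-output pairs to an estimator. -/
abbrev Oracle (A : Type w) : Type w := List (A × ℝ) → A → ℝ

/-- The history `(a 0, b 0), …, (a (t-1), b (t-1))`. -/
def pastPairs {A : Type w} (a : ℕ → A) (b : ℕ → ℝ) (t : ℕ) : List (A × ℝ) :=
  (List.range t).map fun s => (a s, b s)

/-- `O` is an online regression oracle for the class `F` of functions from `D` to `R`, with
prediction error bound `Est` over `T` rounds: its estimators map `D` to `R`, and on every sequence
of inputs in `D` and outputs in `R` its cumulative squared error exceeds that of the best function
in `F` by at most `Est`. -/
structure IsOnlineRegressionOracle {A : Type w} (D : Set A) (R : Set ℝ) (F : Set (A → ℝ))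
    (O : Oracle A) (T : ℕ) (Est : ℝ) : Prop where
  class_mapsTo : ∀ f ∈ F, Set.MapsTo f D R
  estimator_mapsTo : ∀ (a : ℕ → A) (b : ℕ → ℝ), (∀ t < T, a t ∈ D) → (∀ t < T, b t ∈ R) →
    ∀ t < T, Set.MapsTo (O (pastPairs a b t)) D R
  regret_le : ∀ (a : ℕ → A) (b : ℕ → ℝ), (∀ t < T, a t ∈ D) → (∀ t < T, b t ∈ R) →
    ∑ t ∈ Finset.range T, (O (pastPairs a b t) (a t) - b t) ^ 2
      - ⨅ f : F, ∑ t ∈ Finset.range T, (f.1 (a t) - b t) ^ 2 ≤ Est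

/-- `F` is `ε`-misspecified on `D` with respect to the ground truth `g`. -/
def IsMisspecified {A : Type w} (D : Set A) (F : Set (A → ℝ)) (ε : ℝ) (g : A → ℝ) : Prop :=
  ∃ f ∈ F, ∀ a ∈ D, |f a - g a| ≤ ε

/-! ### Inverse gap weighting -/

/-- The gap between the loss `g i` and the smallest loss. -/
def gap {K : ℕ} (g : Fin K → ℝ) (i : Fin K) : ℝ := g i - ⨅ j, g j

theorem gap_nonneg {K : ℕ} (g : Fin K → ℝ) (i : Fin K) : 0 ≤ gap g i :=
  sub_nonneg.2 (ciInf_le (Set.finite_range g).bddBelow i)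

theorem exists_normalizer {K : ℕ} [NeZero K] (γ : NNReal) (g : Fin K → ℝ) :
    ∃ l : ℝ, 0 < l ∧ l ≤ K ∧ ∑ i, 1 / (l + 2 * γ * gap g i) = 1 := by
  have hK : (1 : ℝ) ≤ K := by exact_mod_cast NeZero.one_le
  obtain ⟨j, hj⟩ := exists_eq_ciInf_of_finite (f := g)
  have hpos : ∀ l : ℝ, 0 < l → ∀ i, l ≤ l + 2 * γ * gap g i := fun l _ i => by
    have := mul_nonneg (mul_nonneg zero_le_two γ.2) (gap_nonneg g i)
    exact le_add_of_nonneg_right this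
  have hcont : ContinuousOn (fun l : ℝ => ∑ i, 1 / (l + 2 * γ * gap g i)) (Set.Icc 1 K) := by
    refine continuousOn_finsetSum _ fun i _ => ContinuousOn.div (by fun_prop) (by fun_prop) ?_
    intro l hl
    have h0 : 0 < l := lt_of_lt_of_le one_pos hl.1
    exact (lt_of_lt_of_le h0 (hpos l h0 i)).ne'
  have hlo : 1 ≤ ∑ i, 1 / ((1 : ℝ) + 2 * γ * gap g i) := by
    have h1 : 1 / ((1 : ℝ) + 2 * γ * gap g j) = 1 := by simp [gap, hj]
    calc (1 : ℝ) = 1 / ((1 : ℝ) + 2 * γ * gap g j) := h1.symm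
      _ ≤ _ := Finset.single_le_sum (f := fun i => 1 / ((1 : ℝ) + 2 * γ * gap g i))
          (fun i _ => one_div_nonneg.2 (zero_le_one.trans (hpos 1 one_pos i))) (Finset.mem_univ j)
  have hhi : ∑ i, 1 / ((K : ℝ) + 2 * γ * gap g i) ≤ 1 := by
    have hK0 : (0 : ℝ) < K := lt_of_lt_of_le one_pos hK
    calc ∑ i, 1 / ((K : ℝ) + 2 * γ * gap g i) ≤ ∑ _i : Fin K, 1 / (K : ℝ) :=
          Finset.sum_le_sum fun i _ => one_div_le_one_div_of_le hK0 (hpos K hK0 i)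
      _ = 1 := by simp [hK0.ne']
  obtain ⟨l, hl, h⟩ := intermediate_value_Icc' hK hcont ⟨hhi, hlo⟩
  exact ⟨l, lt_of_lt_of_le one_pos hl.1, hl.2, h⟩

/-- The normalization constant `λ` (it is unique, as the sum is strictly decreasing in `λ`). -/
def normalizer {K : ℕ} [NeZero K] (γ : NNReal) (g : Fin K → ℝ) : ℝ :=
  (exists_normalizer γ g).choose

/-- The inverse gap weighting distribution on `Fin K` for the losses `g`, with exploration
parameter `γ`: index `i` has probability `1 / (λ + 2 γ (g i - min g))`. -/
def igw {K : ℕ} [NeZero K] (γ : NNReal) (g : Fin K → ℝ) : PMF (Fin K) :=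
  PMF.ofFintype (fun i => ENNReal.ofReal (1 / (normalizer γ g + 2 * γ * gap g i))) <| by
    have h := (exists_normalizer γ g).choose_spec
    rw [← ENNReal.ofReal_sum_of_nonneg]
    · rw [show (1 : ENNReal) = ENNReal.ofReal 1 by simp]
      exact congrArg ENNReal.ofReal h.2.2
    · intro i _
      have h1 := mul_nonneg (mul_nonneg zero_le_two γ.2) (gap_nonneg g i)
      exact one_div_nonneg.2 (add_nonneg h.1.le h1)

/-! ### The algorithm -/

/-- The uniform price grid `0 = p₁ < ⋯ < p_K = 1`. -/
def gridPrice (K : ℕ) (i : Fin K) : ℝ := (i : ℝ) / ((K : ℝ) - 1)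

/-- The record of one period: context, demand and posted price. -/
structure Round {n : ℕ} (Θ : Fin n → Type v) where
  context : (i : Fin n) → Θ i
  demand : ℝ
  price : ℝ

/-- A (possibly adaptive) choice of the context and the demand of the next period, given the past
periods. A fixed sequence is the case of a choice that only looks at the number of past periods. -/
abbrev Environment {n : ℕ} (Θ : Fin n → Type v) : Type v :=
  List (Round Θ) → ((i : Fin n) → Θ i) × ℝ

/-- The environment only produces contexts of the market and demands in `[dlo, dhi]`. -/
def Environment.IsAdmissible (env : Environment Θ) (M : Market Φ Θ) (dlo dhi : ℝ) : Prop :=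
  ∀ H, (env H).1 ∈ M.contexts ∧ (env H).2 ∈ Set.Icc dlo dhi

/-- The estimator that the oracle has after the past periods `H`, in each of which it was updated
with the context, the price and the observed production. -/
def Market.estimator (M : Market Φ Θ) (O : Oracle (((i : Fin n) → Θ i) × ℝ))
    (H : List (Round Θ)) : ((i : Fin n) → Θ i) × ℝ → ℝ :=
  O (H.map fun r => ((r.context, r.price), M.production (r.context, r.price)))

/-- The distribution `Δ_t` of the (index of the) next price after the past periods `H`. -/
def Market.priceDist (M : Market Φ Θ) (O : Oracle (((i : Fin n) → Θ i) × ℝ))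
    (env : Environment Θ) (K : ℕ) [NeZero K] (γ : NNReal) (H : List (Round Θ)) : PMF (Fin K) :=
  igw γ fun i => |M.estimator O H ((env H).1, gridPrice K i) - (env H).2|

/-- The law of the first `t` periods under the algorithm. -/
def Market.run (M : Market Φ Θ) (O : Oracle (((i : Fin n) → Θ i) × ℝ))
    (env : Environment Θ) (K : ℕ) [NeZero K] (γ : NNReal) : ℕ → PMF (List (Round Θ))
  | 0 => PMF.pure []
  | t + 1 => (Market.run M O env K γ t).bind fun H =>
      (M.priceDist O env K γ H).map fun i => H ++ [⟨(env H).1, (env H).2, gridPrice K i⟩]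

/-- `∑ t ≤ T, E_{p_t ∼ Δ_t} [ℓ_t (p_t) | H_{t-1}]` for a per-period metric `ℓ`, along the history
`H` of `T` periods. -/
def Market.expectedMetric (M : Market Φ Θ) (O : Oracle (((i : Fin n) → Θ i) × ℝ))
    (env : Environment Θ) (K : ℕ) [NeZero K] (γ : NNReal)
    (loss : (Fin n → ℝ → ℝ) → ℝ → ℝ → ℝ) (T : ℕ) (H : List (Round Θ)) : ℝ :=
  ∑ t ∈ Finset.range T, ∑ i : Fin K, (M.priceDist O env K γ (H.take t) i).toReal *
    loss (M.costs (env (H.take t)).1) (env (H.take t)).2 (gridPrice K i)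

/-- The right-hand side of the regret bound, up to the constant factor. -/
def rate (T K : ℕ) (Est ε δ : ℝ) : ℝ :=
  √(K * T * Est) + ε * √K * T + T / K + √(K * T * Real.log (1 / δ))

end EqPricing

end

/-! All three metrics reduce to the imbalance |x*(p) − d|. The dual optimum clears the market
(`IsDualOptimal.totalSupply_eq`), so unmet demand and cost regret are at most the imbalance when p
lies in [0,1]. Payment regret also involves p − p*. A supplier active at p* has marginal cost equal
to the price, so smoothness makes the inverse of x* Lipschitz above p*
(`sub_le_mul_totalSupply_sub`). Conversely, strong convexity makes x* Lipschitz, so some grid price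
has imbalance O(1/K).

Inverse gap weighting (`sum_igw_mul_le`) bounds the expected imbalance by that of this grid price,
plus 2K/γ, plus γ times the expected squared error of the estimator. The oracle and the
misspecification control only the realized squared errors, by Est + ε²T. An exponential
supermartingale (`Market.tsum_exp_excess_le`) and Markov's inequality pass from realized to expected
errors, up to constant factors and a log(1/δ) term. Only this step is probabilistic, and one good
event serves all three metrics. The choice of γ balances exploration against estimation. -/

namespace EqPricing

variable {n : ℕ} {Φ : Fin n → Type u} {Θ : Fin n → Type v}

/-! ### Response of a single supplier to a price -/

section Supply

variable {μ β xbar : ℝ} {c : ℝ → ℝ}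

/-- Strong convexity is applied to 1 as a convex combination of y and 0, with c 1 ≥ 0 by
monotonicity. -/
theorem IsCost.quadratic_growth (hc : IsCost μ β xbar c) {y : ℝ} (hy : 1 ≤ y) :
    μ / 2 * (y - 1) * y ≤ c y := by
  have hy0 : 0 < y := one_pos.trans_le hy
  have hconv := hc.strongConvex.2
  have h := @hconv y (Set.mem_Ici.2 hy0.le) 0 (Set.mem_Ici.2 le_rfl)
    (1 / y) (1 - 1 / y) (by positivity)
    (sub_nonneg.2 ((div_le_one hy0).2 hy)) (by ring)
  simp only [smul_eq_mul, mul_zero, add_zero, hc.zero, sub_zero, Real.norm_eq_abs, sq_abs] at h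
  rw [one_div_mul_cancel hy0.ne'] at h
  have h1 : 0 ≤ c 1 := by
    simpa [hc.zero] using hc.mono (Set.mem_Ici.2 le_rfl) (Set.mem_Ici.2 zero_le_one) zero_le_one
  have h2 : 1 / y * (1 - 1 / y) * (μ / 2 * y ^ 2) = μ / 2 * (y - 1) := by field_simp
  rw [h2] at h
  have h3 : μ / 2 * (y - 1) ≤ 1 / y * c y := by linarith
  calc μ / 2 * (y - 1) * y ≤ 1 / y * c y * y := by gcongr
    _ = c y := by field_simp

theorem IsCost.exists_isMaxOn (hμ : 0 < μ) (hc : IsCost μ β xbar c) (p : ℝ) :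
    ∃ x, x ∈ Set.Ici (0 : ℝ) ∧ IsMaxOn (fun y => p * y - c y) (Set.Ici 0) x := by
  -- Beyond R, quadratic growth gives c y ≥ |p| y, so the profit there is at most 0, its value at y
  -- = 0.
  set R : ℝ := 1 + 2 * |p| / μ with hR
  have hR1 : 1 ≤ R := le_add_of_nonneg_right (by positivity)
  have hcont : ContinuousOn (fun y => p * y - c y) (Set.Icc 0 R) :=
    (continuousOn_const.mul continuousOn_id).sub
      (hc.contDiff.continuousOn.mono Set.Icc_subset_Ici_self)
  obtain ⟨x, hx, hmax⟩ := isCompact_Icc.exists_isMaxOn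
    (Set.nonempty_Icc.2 (zero_le_one.trans hR1)) hcont
  refine ⟨x, hx.1, fun y hy => ?_⟩
  rcases le_or_gt y R with h | h
  · exact hmax ⟨hy, h⟩
  · have h0 : p * 0 - c 0 ≤ p * x - c x := hmax ⟨le_rfl, zero_le_one.trans hR1⟩
    have h1 := hc.quadratic_growth (hR1.trans h.le)
    have h2 : |p| ≤ μ / 2 * (y - 1) := by
      have : 2 * |p| / μ ≤ y - 1 := by linarith
      rw [div_le_iff₀ hμ] at this
      linarith
    have h3 : p * y ≤ μ / 2 * (y - 1) * y :=
      mul_le_mul_of_nonneg_right ((le_abs_self p).trans h2) hy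
    simp only [hc.zero, mul_zero, sub_zero] at h0
    show p * y - c y ≤ p * x - c x
    linarith

theorem IsCost.supply_spec (hμ : 0 < μ) (hc : IsCost μ β xbar c) (p : ℝ) :
    supply c p ∈ Set.Ici (0 : ℝ) ∧ IsMaxOn (fun y => p * y - c y) (Set.Ici 0) (supply c p) :=
  Classical.epsilon_spec (hc.exists_isMaxOn hμ p)

theorem IsCost.supply_nonneg (hμ : 0 < μ) (hc : IsCost μ β xbar c) (p : ℝ) : 0 ≤ supply c p :=
  (hc.supply_spec hμ p).1

theorem IsCost.profit_le (hμ : 0 < μ) (hc : IsCost μ β xbar c) (p : ℝ) {y : ℝ} (hy : 0 ≤ y) :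
    p * y - c y ≤ p * supply c p - c (supply c p) :=
  (hc.supply_spec hμ p).2 hy

/-- The maximizer is compared with the midpoint of itself and y. This yields μ/4 instead of the
sharp μ/2, which costs only a constant. -/
theorem IsCost.profit_add_sq_le (hμ : 0 < μ) (hc : IsCost μ β xbar c) (p : ℝ) {y : ℝ}
    (hy : 0 ≤ y) :
    p * y - c y + μ / 4 * (supply c p - y) ^ 2 ≤ p * supply c p - c (supply c p) := by
  have hx := hc.supply_nonneg hμ p
  have hconv := hc.strongConvex.2
  have h := @hconv _ (Set.mem_Ici.2 hx) _ (Set.mem_Ici.2 hy) (1 / 2) (1 / 2)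
    (by norm_num) (by norm_num) (by norm_num)
  simp only [smul_eq_mul, Real.norm_eq_abs, sq_abs] at h
  have h1 := hc.profit_le hμ p (y := 1 / 2 * supply c p + 1 / 2 * y) (by positivity)
  linarith

/-- Adding the quadratic profit gaps at p and at q cancels the costs. Monotonicity and the Lipschitz
bound for supply both follow. -/
theorem IsCost.sq_supply_sub_le (hμ : 0 < μ) (hc : IsCost μ β xbar c) (p q : ℝ) :
    μ / 2 * (supply c p - supply c q) ^ 2 ≤ (p - q) * (supply c p - supply c q) := by
  have h1 := hc.profit_add_sq_le hμ p (hc.supply_nonneg hμ q)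
  have h2 := hc.profit_add_sq_le hμ q (hc.supply_nonneg hμ p)
  linarith

theorem IsCost.supply_mono (hμ : 0 < μ) (hc : IsCost μ β xbar c) : Monotone (supply c) := by
  intro p q hpq
  have h := hc.sq_supply_sub_le hμ q p
  by_contra! hlt
  have h1 : 0 < μ / 2 * (supply c q - supply c p) ^ 2 :=
    mul_pos (half_pos hμ) (sq_pos_of_neg (sub_neg.2 hlt))
  have h2 : (q - p) * (supply c q - supply c p) ≤ 0 :=
    mul_nonpos_of_nonneg_of_nonpos (sub_nonneg.2 hpq) (sub_nonpos.2 hlt.le)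
  linarith

theorem IsCost.abs_supply_sub_le (hμ : 0 < μ) (hc : IsCost μ β xbar c) (p q : ℝ) :
    |supply c p - supply c q| ≤ 2 / μ * |p - q| := by
  have h := hc.sq_supply_sub_le hμ p q
  have h1 : μ / 2 * |supply c p - supply c q| * |supply c p - supply c q|
      ≤ |p - q| * |supply c p - supply c q| := by
    rw [mul_assoc, abs_mul_abs_self, ← abs_mul]
    exact le_trans (by linarith [sq (supply c p - supply c q)]) (le_abs_self _)
  rcases (abs_nonneg (supply c p - supply c q)).eq_or_lt with h0 | h0
  · rw [← h0]; positivity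
  · have h2 := le_of_mul_le_mul_right h1 h0
    rw [div_mul_eq_mul_div, le_div_iff₀ hμ]
    linarith

/-- First-order condition; positivity of the production makes the maximizer interior. -/
theorem IsCost.derivWithin_supply (hμ : 0 < μ) (hc : IsCost μ β xbar c) {p : ℝ}
    (hx : 0 < supply c p) : derivWithin c (Set.Ici 0) (supply c p) = p := by
  have hnhds : Set.Ici (0 : ℝ) ∈ nhds (supply c p) := Ici_mem_nhds hx
  have hd : DifferentiableAt ℝ c (supply c p) :=
    ((hc.contDiff.differentiableOn one_ne_zero) _ hx.le).differentiableAt hnhds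
  have hmax : IsLocalMax (fun y => p * y - c y) (supply c p) :=
    (hc.supply_spec hμ p).2.isLocalMax hnhds
  have h := hmax.hasDerivAt_eq_zero (((hasDerivAt_id _).const_mul p).sub hd.hasDerivAt)
  rw [derivWithin_of_mem_nhds hnhds]
  linarith

theorem IsCost.iInf_eq (hμ : 0 < μ) (hc : IsCost μ β xbar c) (p : ℝ) :
    ⨅ x : Set.Ici (0 : ℝ), (c x - p * x) = c (supply c p) - p * supply c p := by
  have hle : ∀ x : Set.Ici (0 : ℝ), c (supply c p) - p * supply c p ≤ c x - p * x := fun x => by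
    linarith [hc.profit_le hμ p x.2]
  exact le_antisymm (ciInf_le ⟨_, Set.forall_mem_range.2 hle⟩ ⟨supply c p, hc.supply_nonneg hμ p⟩)
    (le_ciInf hle)

end Supply

/-! ### Market clearing, and the metrics in terms of the imbalance -/

section Equilibrium

variable {μ β xbar : ℝ} {C : Fin n → ℝ → ℝ}

theorem totalSupply_nonneg (hμ : 0 < μ) (hC : ∀ i, IsCost μ β xbar (C i)) (p : ℝ) :
    0 ≤ totalSupply C p :=
  Finset.sum_nonneg fun i _ => (hC i).supply_nonneg hμ p

theorem supply_le_totalSupply (hμ : 0 < μ) (hC : ∀ i, IsCost μ β xbar (C i)) (i : Fin n)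
    (p : ℝ) : supply (C i) p ≤ totalSupply C p :=
  Finset.single_le_sum (f := fun i => supply (C i) p)
    (fun i _ => (hC i).supply_nonneg hμ p) (Finset.mem_univ i)

theorem abs_totalSupply_sub_le (hμ : 0 < μ) (hC : ∀ i, IsCost μ β xbar (C i)) (p q : ℝ) :
    |totalSupply C p - totalSupply C q| ≤ 2 * n / μ * |p - q| := by
  unfold totalSupply
  rw [← Finset.sum_sub_distrib]
  calc |∑ i, (supply (C i) p - supply (C i) q)|
      ≤ ∑ i, |supply (C i) p - supply (C i) q| := Finset.abs_sum_le_sum_abs _ _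
    _ ≤ ∑ _i : Fin n, 2 / μ * |p - q| :=
        Finset.sum_le_sum fun i _ => (hC i).abs_supply_sub_le hμ p q
    _ = 2 * n / μ * |p - q| := by simp; ring

theorem continuous_totalSupply (hμ : 0 < μ) (hC : ∀ i, IsCost μ β xbar (C i)) :
    Continuous (totalSupply C) := by
  have h : 0 ≤ 2 * (n : ℝ) / μ := by positivity
  refine (LipschitzWith.of_dist_le_mul (K := ⟨_, h⟩) fun p q => ?_).continuous
  exact abs_totalSupply_sub_le hμ hC p q

theorem dualValue_eq (hμ : 0 < μ) (hC : ∀ i, IsCost μ β xbar (C i)) (d p : ℝ) :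
    dualValue C d p = p * d + ∑ i, (C i (supply (C i) p) - p * supply (C i) p) := by
  unfold dualValue
  simp_rw [fun i => (hC i).iInf_eq hμ p]

/-- The production at q is feasible but suboptimal at p. Hence d − x*(q) is a supergradient at q of
the concave dual function. -/
theorem dualValue_sub_ge (hμ : 0 < μ) (hC : ∀ i, IsCost μ β xbar (C i)) (d p q : ℝ) :
    (q - p) * (d - totalSupply C q) ≤ dualValue C d q - dualValue C d p := by
  rw [dualValue_eq hμ hC, dualValue_eq hμ hC, totalSupply]
  have h : ∑ i, (C i (supply (C i) p) - p * supply (C i) p) ≤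
      ∑ i, (C i (supply (C i) q) - q * supply (C i) q + (q - p) * supply (C i) q) :=
    Finset.sum_le_sum fun i _ => by
      linarith [(hC i).profit_le hμ p ((hC i).supply_nonneg hμ q)]
  rw [Finset.sum_add_distrib, ← Finset.mul_sum] at h
  linarith

/-- The market clears at an optimal dual variable. -/
theorem IsDualOptimal.totalSupply_eq (hμ : 0 < μ) (hC : ∀ i, IsCost μ β xbar (C i)) {d p : ℝ}
    (hp : IsDualOptimal C d p) : totalSupply C p = d := by
  -- Optimality of p forces x*(q) ≤ d for q < p and x*(q) ≥ d for q > p; continuity of x* then gives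
  -- equality at p.
  have hmul : ∀ q, (q - p) * (d - totalSupply C q) ≤ 0 := fun q =>
    (dualValue_sub_ge hμ hC d p q).trans (sub_nonpos.2 (hp q))
  have hcont := (continuous_totalSupply hμ hC).continuousAt (x := p)
  apply le_antisymm
  · refine le_of_tendsto (hcont.mono_left (nhdsWithin_le_nhds (s := Set.Iio p))) ?_
    filter_upwards [self_mem_nhdsWithin] with q hq
    have : q - p < 0 := sub_neg.2 hq
    nlinarith [hmul q]
  · refine ge_of_tendsto (hcont.mono_left (nhdsWithin_le_nhds (s := Set.Ioi p))) ?_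
    filter_upwards [self_mem_nhdsWithin] with q hq
    have : 0 < q - p := sub_pos.2 hq
    nlinarith [hmul q]

theorem exists_supply_pos {p : ℝ} (h : 0 < totalSupply C p) : ∃ i, 0 < supply (C i) p := by
  obtain ⟨i, -, hi⟩ := Finset.exists_lt_of_sum_lt (s := Finset.univ)
    (f := fun _ => (0 : ℝ)) (g := fun i => supply (C i) p) (by simpa [totalSupply] using h)
  exact ⟨i, hi⟩

/-- Each supply is monotone, so equal totals force equal individual productions; the marginal cost
of an active supplier is then both p and q. -/
theorem eq_of_totalSupply_eq (hμ : 0 < μ) (hC : ∀ i, IsCost μ β xbar (C i)) {p q : ℝ}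
    (h0 : 0 < totalSupply C p) (h : totalSupply C p = totalSupply C q) (hpq : p ≤ q) : p = q := by
  obtain ⟨i, hi⟩ := exists_supply_pos h0
  have hle : ∀ j ∈ Finset.univ, supply (C j) p ≤ supply (C j) q := fun j _ =>
    (hC j).supply_mono hμ hpq
  have heq := (Finset.sum_eq_sum_iff_of_le hle).1 h i (Finset.mem_univ i)
  rw [← (hC i).derivWithin_supply hμ hi, heq, (hC i).derivWithin_supply hμ (heq ▸ hi)]

theorem IsDualOptimal.unique (hμ : 0 < μ) (hC : ∀ i, IsCost μ β xbar (C i)) {d p q : ℝ}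
    (hd : 0 < d) (hp : IsDualOptimal C d p) (hq : IsDualOptimal C d q) : p = q := by
  have h1 := hp.totalSupply_eq hμ hC
  have h2 := hq.totalSupply_eq hμ hC
  rcases le_total p q with h | h
  · exact eq_of_totalSupply_eq hμ hC (h1 ▸ hd) (h1.trans h2.symm) h
  · exact (eq_of_totalSupply_eq hμ hC (h2 ▸ hd) (h2.trans h1.symm) h).symm

/-- `eqPrice` is an arbitrary optimal dual variable, while the hypothesis only provides some optimum
in [0,1]; uniqueness for d > 0 identifies the two. -/
theorem eqPrice_spec (hμ : 0 < μ) (hC : ∀ i, IsCost μ β xbar (C i)) {d : ℝ} (hd : 0 < d)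
    (h : ∃ p ∈ Set.Icc (0 : ℝ) 1, IsDualOptimal C d p) :
    eqPrice C d ∈ Set.Icc (0 : ℝ) 1 ∧ totalSupply C (eqPrice C d) = d := by
  obtain ⟨p, hp, hopt⟩ := h
  have he : IsDualOptimal C d (eqPrice C d) := Classical.epsilon_spec ⟨p, hopt⟩
  exact ⟨he.unique hμ hC hd hopt ▸ hp, he.totalSupply_eq hμ hC⟩

/-- For a supplier active at p, the price difference is a difference of marginal costs, at most β
times its extra production; the other suppliers do not produce less at q. The absolute value avoids
a sign assumption on β. -/
theorem sub_le_mul_totalSupply_sub (hμ : 0 < μ) (hC : ∀ i, IsCost μ β xbar (C i)) {p q : ℝ}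
    (h0 : 0 < totalSupply C p) (hpq : p ≤ q) (hq : totalSupply C q ≤ xbar) :
    q - p ≤ |β| * (totalSupply C q - totalSupply C p) := by
  obtain ⟨i, hi⟩ := exists_supply_pos h0
  have hmono := (hC i).supply_mono hμ hpq
  have hqx := (supply_le_totalSupply hμ hC i q).trans hq
  have hs := (hC i).smooth (supply (C i) q) ⟨(hC i).supply_nonneg hμ q, hqx⟩
    (supply (C i) p) ⟨hi.le, hmono.trans hqx⟩
  rw [(hC i).derivWithin_supply hμ hi, (hC i).derivWithin_supply hμ (hi.trans_le hmono),
    abs_of_nonneg (sub_nonneg.2 hpq), abs_of_nonneg (sub_nonneg.2 hmono)] at hs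
  refine hs.trans (mul_le_mul (le_abs_self β) ?_ (sub_nonneg.2 hmono) (abs_nonneg β))
  unfold totalSupply
  rw [← Finset.sum_sub_distrib]
  exact Finset.single_le_sum (f := fun i => supply (C i) q - supply (C i) p)
    (fun j _ => sub_nonneg.2 ((hC j).supply_mono hμ hpq)) (Finset.mem_univ i)

theorem unmetDemand_le (d p : ℝ) : unmetDemand C d p ≤ |totalSupply C p - d| := by
  rw [abs_sub_comm]
  exact max_le (le_abs_self _) (abs_nonneg _)

theorem costRegret_le (hμ : 0 < μ) (hC : ∀ i, IsCost μ β xbar (C i)) {d : ℝ} (hd : 0 < d)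
    (h : ∃ p ∈ Set.Icc (0 : ℝ) 1, IsDualOptimal C d p) {p : ℝ} (hp : p ∈ Set.Icc (0 : ℝ) 1) :
    costRegret C d p ≤ |totalSupply C p - d| := by
  obtain ⟨-, hclear⟩ := eqPrice_spec hμ hC hd h
  -- At price p each supplier prefers its own production to its equilibrium production.
  have hle : costRegret C d p ≤ p * (totalSupply C p - totalSupply C (eqPrice C d)) := by
    unfold costRegret totalSupply
    rw [← Finset.sum_sub_distrib, Finset.mul_sum]
    exact Finset.sum_le_sum fun i _ => by
      linarith [(hC i).profit_le hμ p ((hC i).supply_nonneg hμ (eqPrice C d))]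
  rw [hclear] at hle
  calc _ ≤ p * (totalSupply C p - d) := hle
    _ ≤ p * |totalSupply C p - d| := mul_le_mul_of_nonneg_left (le_abs_self _) hp.1
    _ ≤ _ := mul_le_of_le_one_left (abs_nonneg _) hp.2

theorem paymentRegret_le (hμ : 0 < μ) (hC : ∀ i, IsCost μ β xbar (C i)) {d : ℝ} (hd : 0 < d)
    (h : ∃ p ∈ Set.Icc (0 : ℝ) 1, IsDualOptimal C d p) {p : ℝ} (hp : p ∈ Set.Icc (0 : ℝ) 1)
    (hx : totalSupply C p ≤ xbar) :
    paymentRegret C d p ≤ (1 + |β| * d) * |totalSupply C p - d| := by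
  obtain ⟨-, hclear⟩ := eqPrice_spec hμ hC hd h
  have heq : paymentRegret C d p = p * (totalSupply C p - d) + (p - eqPrice C d) * d := by
    unfold paymentRegret
    rw [Finset.sum_sub_distrib, ← Finset.mul_sum, ← Finset.mul_sum]
    change p * totalSupply C p - eqPrice C d * totalSupply C (eqPrice C d) = _
    rw [hclear]
    ring
  have h1 : p * (totalSupply C p - d) ≤ |totalSupply C p - d| :=
    (mul_le_mul_of_nonneg_left (le_abs_self _) hp.1).trans
      (mul_le_of_le_one_left (abs_nonneg _) hp.2)
  -- Only overpricing needs the inverse Lipschitz bound; below equilibrium the left side is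
  -- nonpositive.
  have h2 : p - eqPrice C d ≤ |β| * |totalSupply C p - d| := by
    rcases le_total p (eqPrice C d) with hle | hle
    · exact (sub_nonpos.2 hle).trans (by positivity)
    · have := sub_le_mul_totalSupply_sub hμ hC (hclear.symm ▸ hd) hle hx
      rw [hclear] at this
      exact this.trans (mul_le_mul_of_nonneg_left (le_abs_self _) (abs_nonneg β))
  have h3 := mul_le_mul_of_nonneg_right h2 hd.le
  rw [heq]
  linarith

end Equilibrium

/-! ### The inverse gap weighting inequality -/

section InverseGapWeighting

variable {K : ℕ} [NeZero K]

theorem igw_toReal (γ : NNReal) (g : Fin K → ℝ) (i : Fin K) :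
    (igw γ g i).toReal = 1 / (normalizer γ g + 2 * γ * gap g i) := by
  have h := (exists_normalizer γ g).choose_spec.1
  have h1 := mul_nonneg (mul_nonneg zero_le_two γ.2) (gap_nonneg g i)
  exact ENNReal.toReal_ofReal (one_div_nonneg.2 (add_nonneg h.le h1))

theorem sum_toReal_eq_one {ι : Type*} [Fintype ι] (p : PMF ι) : ∑ i, (p i).toReal = 1 := by
  rw [← ENNReal.toReal_sum fun i _ => p.apply_ne_top i, ← tsum_fintype (L := .unconditional _),
    p.tsum_coe, ENNReal.toReal_one]

theorem mul_le_sq_add_inv {a x : ℝ} (ha : 0 < a) : x ≤ a / 2 * x ^ 2 + 1 / (2 * a) := by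
  have h : a / 2 * x ^ 2 + 1 / (2 * a) - x = (a * x - 1) ^ 2 / (2 * a) := by field_simp; ring
  have : 0 ≤ (a * x - 1) ^ 2 / (2 * a) := by positivity
  linarith

/-- The inverse gap weighting inequality: the expected loss exceeds the loss of any index by at
most the exploration cost plus the expected squared estimation error. -/
theorem sum_igw_mul_le {γ : NNReal} (hγ : 0 < (γ : ℝ)) (g h : Fin K → ℝ) (k : Fin K) :
    ∑ i, (igw γ g i).toReal * h i ≤
      h k + 2 * K / γ + γ * ∑ i, (igw γ g i).toReal * (g i - h i) ^ 2 := by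
  obtain ⟨hl0, hlK, -⟩ := (exists_normalizer γ g).choose_spec
  change 0 < normalizer γ g at hl0
  change normalizer γ g ≤ K at hlK
  set l := normalizer γ g
  set Δ : Fin K → ℝ := fun i => (igw γ g i).toReal with hΔ
  have hgap : ∀ i, 0 ≤ gap g i := gap_nonneg g
  have hden : ∀ i, 0 < l + 2 * γ * gap g i := fun i => by have := hgap i; positivity
  have hΔeq : ∀ i, Δ i = 1 / (l + 2 * γ * gap g i) := igw_toReal γ g
  have hΔpos : ∀ i, 0 < Δ i := fun i => by rw [hΔeq]; exact one_div_pos.2 (hden i)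
  have hsum : ∑ i, Δ i = 1 := sum_toReal_eq_one _
  have hK1 : (1 : ℝ) ≤ K := by exact_mod_cast NeZero.one_le
  -- Exploration cost: the weight of an index is at most 1/(2γ gap), so each term contributes at
  -- most 1/(2γ).
  have h1 : ∑ i, Δ i * gap g i ≤ K * (1 / (2 * γ)) := by
    have : ∀ i ∈ Finset.univ, Δ i * gap g i ≤ 1 / (2 * γ) := fun i _ => by
      rw [hΔeq, one_div_mul_eq_div, div_le_div_iff₀ (hden i) (by positivity)]
      linarith
    simpa using Finset.sum_le_card_nsmul _ _ _ this
  have h2 : ∑ i, Δ i * (h i - g i) ≤ γ / 2 * ∑ i, Δ i * (g i - h i) ^ 2 + 1 / (2 * γ) := by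
    calc ∑ i, Δ i * (h i - g i)
        ≤ ∑ i, (γ / 2 * (Δ i * (g i - h i) ^ 2) + Δ i * (1 / (2 * γ))) :=
          Finset.sum_le_sum fun i _ => by
            have := mul_le_mul_of_nonneg_left (mul_le_sq_add_inv hγ (x := h i - g i)) (hΔpos i).le
            linarith [this, sq (h i - g i), sq (g i - h i)]
      _ = _ := by rw [Finset.sum_add_distrib, ← Finset.mul_sum, ← Finset.sum_mul, hsum, one_mul]
  -- AM-GM with parameter γ Δ k: its remainder 1/(2γ Δ k) equals λ/(2γ) plus the gap of k, which the
  -- left side subtracts.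
  have h3 : g k - h k - gap g k ≤ γ / 2 * (Δ k * (g k - h k) ^ 2) + K / (2 * γ) := by
    have h4 := mul_le_sq_add_inv (mul_pos hγ (hΔpos k)) (x := g k - h k)
    have h5 : 1 / (2 * (γ * Δ k)) = l / (2 * γ) + gap g k := by
      rw [hΔeq]
      have := (hden k).ne'
      field_simp
    have h6 : l / (2 * γ) ≤ K / (2 * γ) := by gcongr
    rw [h5] at h4
    linarith
  have h7 : Δ k * (g k - h k) ^ 2 ≤ ∑ i, Δ i * (g i - h i) ^ 2 :=
    Finset.single_le_sum (f := fun i => Δ i * (g i - h i) ^ 2)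
      (fun i _ => mul_nonneg (hΔpos i).le (sq_nonneg _)) (Finset.mem_univ k)
  have h8 : ∑ i, Δ i * h i =
      ∑ i, Δ i * gap g i + ∑ i, Δ i * (h i - g i) + (g k - gap g k) := by
    have : ∀ i, Δ i * h i = Δ i * gap g i + Δ i * (h i - g i) + Δ i * (g k - gap g k) :=
      fun i => by unfold gap; ring
    simp_rw [this, Finset.sum_add_distrib]
    rw [← Finset.sum_mul, hsum, one_mul]
  have h9 : K * (1 / (2 * γ)) + 1 / (2 * γ) + K / (2 * γ) ≤ 2 * K / (γ : ℝ) := by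
    rw [show (K : ℝ) * (1 / (2 * γ)) + 1 / (2 * γ) + K / (2 * γ) = (K + 1 / 2) / γ by
      field_simp; ring]
    gcongr
    linarith
  have h10 := mul_le_mul_of_nonneg_left h7 (half_pos hγ).le
  linarith

end InverseGapWeighting

/-! ### Expectations under a `PMF`, Markov's inequality and an exponential moment bound -/

section Concentration

open Classical in
theorem tsum_pure_mul {α : Type*} (a : α) (g : α → ENNReal) :
    ∑' x, PMF.pure a x * g x = g a := by
  rw [tsum_eq_single a fun x hx => by simp [hx]]
  simp

theorem tsum_bind_mul {α β : Type*} (p : PMF α) (f : α → PMF β) (g : β → ENNReal) :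
    ∑' y, p.bind f y * g y = ∑' x, p x * ∑' y, f x y * g y := by
  simp_rw [PMF.bind_apply, ← ENNReal.tsum_mul_right, ← ENNReal.tsum_mul_left]
  rw [ENNReal.tsum_comm]
  simp_rw [mul_assoc]

theorem tsum_map_mul {α β : Type*} (p : PMF α) (f : α → β) (g : β → ENNReal) :
    ∑' y, p.map f y * g y = ∑' x, p x * g (f x) := by
  rw [PMF.map, tsum_bind_mul]
  simp_rw [Function.comp_apply, tsum_pure_mul]

/-- Markov's inequality in the form of a high-probability statement. -/
theorem ofReal_one_sub_le_toOuterMeasure {α : Type*} (p : PMF α) (g : α → ENNReal) {δ : ℝ}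
    (hδ : 0 < δ) (hg : ∑' x, p x * g x ≤ 1) {S : Set α}
    (hS : ∀ x ∈ p.support, x ∉ S → 1 ≤ ENNReal.ofReal δ * g x) :
    ENNReal.ofReal (1 - δ) ≤ p.toOuterMeasure S := by
  have hcompl : p.toOuterMeasure Sᶜ ≤ ENNReal.ofReal δ := by
    rw [PMF.toOuterMeasure_apply]
    calc ∑' x, Sᶜ.indicator p x ≤ ∑' x, ENNReal.ofReal δ * (p x * g x) := by
          refine ENNReal.tsum_le_tsum fun x => ?_
          by_cases hx : x ∈ Sᶜ
          · rw [Set.indicator_of_mem hx]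
            by_cases h0 : p x = 0
            · simp [h0]
            · calc p x = p x * 1 := (mul_one _).symm
                _ ≤ p x * (ENNReal.ofReal δ * g x) := by
                  gcongr
                  exact hS x ((p.mem_support_iff x).2 h0) hx
                _ = _ := by ring
          · rw [Set.indicator_of_notMem hx]
            exact zero_le
      _ = ENNReal.ofReal δ * ∑' x, p x * g x := ENNReal.tsum_mul_left
      _ ≤ ENNReal.ofReal δ * 1 := by gcongr
      _ = _ := mul_one _
  have htotal : 1 ≤ p.toOuterMeasure S + p.toOuterMeasure Sᶜ := by
    simp_rw [PMF.toOuterMeasure_apply]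
    rw [← ENNReal.tsum_add, ← p.tsum_coe]
    exact ENNReal.tsum_le_tsum fun x => (Set.indicator_self_add_compl_apply S p x).ge
  rw [ENNReal.ofReal_sub _ hδ.le, ENNReal.ofReal_one, tsub_le_iff_right]
  exact htotal.trans (by gcongr)

/-- With y = x/B in [0,1], (1 + y + y²/2)(1 − y/2) = 1 + y/2 − y³/4 ≥ 1, and the first factor is at
most exp y. -/
theorem exp_neg_div_le {B x : ℝ} (hB : 0 < B) (h0 : 0 ≤ x) (hx : x ≤ B) :
    Real.exp (-(x / B)) ≤ 1 - x / (2 * B) := by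
  set y := x / B with hy
  have hy0 : 0 ≤ y := by positivity
  have hy1 : y ≤ 1 := (div_le_one hB).2 hx
  have h : x / (2 * B) = y / 2 := by rw [hy]; field_simp
  rw [h, Real.exp_neg, inv_le_comm₀ (Real.exp_pos _) (by linarith)]
  refine le_trans ?_ (Real.quadratic_le_exp_of_nonneg hy0)
  rw [inv_le_iff_one_le_mul₀ (by linarith)]
  nlinarith [mul_nonneg hy0 (sub_nonneg.2 hy1), pow_nonneg hy0 3,
    mul_nonneg (mul_nonneg hy0 hy0) (sub_nonneg.2 hy1)]

/-- The moment generating function bound behind the concentration inequality. -/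
theorem sum_mul_exp_le_one {ι : Type*} [Fintype ι] (p : PMF ι) (X : ι → ℝ) {B : ℝ} (hB : 0 < B)
    (h0 : ∀ i, 0 ≤ X i) (hX : ∀ i, X i ≤ B) :
    ∑ i, (p i).toReal * Real.exp ((∑ j, (p j).toReal * X j) / (2 * B) - X i / B) ≤ 1 := by
  set m := ∑ j, (p j).toReal * X j
  have h1 : ∑ i, (p i).toReal * Real.exp (-(X i / B)) ≤ Real.exp (-(m / (2 * B))) := by
    calc ∑ i, (p i).toReal * Real.exp (-(X i / B))
        ≤ ∑ i, ((p i).toReal - (p i).toReal * X i / (2 * B)) :=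
          Finset.sum_le_sum fun i _ => by
            have := mul_le_mul_of_nonneg_left (exp_neg_div_le hB (h0 i) (hX i))
              (ENNReal.toReal_nonneg (a := p i))
            refine this.trans (le_of_eq (by ring))
      _ = 1 - m / (2 * B) := by
          rw [Finset.sum_sub_distrib, sum_toReal_eq_one, ← Finset.sum_div]
      _ ≤ _ := by linarith [Real.add_one_le_exp (-(m / (2 * B)))]
  calc ∑ i, (p i).toReal * Real.exp (m / (2 * B) - X i / B)
      = Real.exp (m / (2 * B)) * ∑ i, (p i).toReal * Real.exp (-(X i / B)) := by
        rw [Finset.mul_sum]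
        refine Finset.sum_congr rfl fun i _ => ?_
        rw [sub_eq_add_neg, Real.exp_add]
        ring
    _ ≤ Real.exp (m / (2 * B)) * Real.exp (-(m / (2 * B))) := by gcongr
    _ = 1 := by rw [← Real.exp_add, add_neg_cancel, Real.exp_zero]

end Concentration

/-! ### Histories, the supermartingale and the oracle guarantee -/

section History

/-- The next period after the past periods `H`, if the `i`-th grid price is posted. -/
noncomputable def Environment.nextRound (env : Environment Θ) (K : ℕ) (H : List (Round Θ))
    (i : Fin K) : Round Θ :=
  ⟨(env H).1, (env H).2, gridPrice K i⟩

/-- The context-price pair of period `s` of the history `H`, with a default value beyond its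
length. -/
noncomputable def Environment.input (env : Environment Θ) (H : List (Round Θ)) (s : ℕ) :
    ((i : Fin n) → Θ i) × ℝ :=
  (H.map fun r => (r.context, r.price)).getD s ((env []).1, 0)

/-- The squared error of the estimator available after the past periods `H`. -/
noncomputable def Market.sqError (M : Market Φ Θ) (O : Oracle (((i : Fin n) → Θ i) × ℝ))
    (H : List (Round Θ)) (a : ((i : Fin n) → Θ i) × ℝ) : ℝ :=
  (M.estimator O H a - M.production a) ^ 2

/-- The expected squared error in the period after the past periods `H`. -/
noncomputable def Market.meanSqError (M : Market Φ Θ) (O : Oracle (((i : Fin n) → Θ i) × ℝ))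
    (env : Environment Θ) (K : ℕ) [NeZero K] (γ : NNReal) (H : List (Round Θ)) : ℝ :=
  ∑ i, (M.priceDist O env K γ H i).toReal * M.sqError O H ((env H).1, gridPrice K i)

/-- The exponent of the supermartingale comparing expected and realized squared errors. -/
noncomputable def Market.excess (M : Market Φ Θ) (O : Oracle (((i : Fin n) → Θ i) × ℝ))
    (env : Environment Θ) (K : ℕ) [NeZero K] (γ : NNReal) (B : ℝ) (t : ℕ)
    (H : List (Round Θ)) : ℝ :=
  ∑ s ∈ Finset.range t, (M.meanSqError O env K γ (H.take s) / (2 * B)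
    - M.sqError O (H.take s) (env.input H s) / B)

theorem gridPrice_mem {K : ℕ} (i : Fin K) : gridPrice K i ∈ Set.Icc (0 : ℝ) 1 := by
  have h : (i : ℝ) + 1 ≤ K := by exact_mod_cast i.2
  have h0 : (0 : ℝ) ≤ i := Nat.cast_nonneg _
  exact ⟨div_nonneg h0 (by linarith), div_le_one_of_le₀ (by linarith) (by linarith)⟩

theorem exists_abs_gridPrice_sub_le {K : ℕ} (hK : 2 ≤ K) {p : ℝ} (hp : p ∈ Set.Icc (0 : ℝ) 1) :
    ∃ i : Fin K, |gridPrice K i - p| ≤ 2 / K := by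
  have hK' : (2 : ℝ) ≤ K := by exact_mod_cast hK
  have hK1 : (0 : ℝ) < (K : ℝ) - 1 := by linarith
  have h0 : 0 ≤ p * ((K : ℝ) - 1) := mul_nonneg hp.1 hK1.le
  -- The witness rounds p down to the grid. The spacing 1/(K − 1) is at most 2/K because K ≥ 2.
  have hfl := Nat.floor_le h0
  have hlt := Nat.lt_floor_add_one (p * ((K : ℝ) - 1))
  have hi : ⌊p * ((K : ℝ) - 1)⌋₊ < K := by
    have : (⌊p * ((K : ℝ) - 1)⌋₊ : ℝ) < K := by nlinarith [hp.2]
    exact_mod_cast this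
  refine ⟨⟨_, hi⟩, ?_⟩
  have h1 : |gridPrice K ⟨_, hi⟩ - p| ≤ 1 / ((K : ℝ) - 1) := by
    rw [gridPrice, abs_le]
    dsimp only
    constructor
    · rw [le_sub_iff_add_le, le_div_iff₀ hK1, add_mul, neg_mul, one_div_mul_cancel hK1.ne']
      linarith
    · rw [sub_le_iff_le_add, div_le_iff₀ hK1, add_mul, one_div_mul_cancel hK1.ne']
      linarith
  refine h1.trans ?_
  rw [div_le_div_iff₀ hK1 (by linarith)]
  linarith

variable {M : Market Φ Θ} {O : Oracle (((i : Fin n) → Θ i) × ℝ)} {env : Environment Θ}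
  {K : ℕ} [NeZero K] {γ : NNReal} {μ β xbar dlo dhi : ℝ}

theorem Market.run_succ (t : ℕ) : M.run O env K γ (t + 1) = (M.run O env K γ t).bind fun H =>
    (M.priceDist O env K γ H).map fun i => H ++ [env.nextRound K H i] := rfl

theorem Market.mem_support_run (hadm : env.IsAdmissible M dlo dhi) : ∀ {t : ℕ}
    {H : List (Round Θ)}, H ∈ (M.run O env K γ t).support →
      H.length = t ∧ ∀ r ∈ H, (r.context, r.price) ∈ M.inputs
  | 0, H, hH => by
    have : H = [] := by simpa [Market.run] using hH
    simp [this]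
  | t + 1, H, hH => by
    rw [Market.run_succ, PMF.mem_support_bind_iff] at hH
    obtain ⟨H', hH', hH⟩ := hH
    rw [PMF.mem_support_map_iff] at hH
    obtain ⟨i, -, rfl⟩ := hH
    obtain ⟨hlen, hmem⟩ := Market.mem_support_run hadm hH'
    refine ⟨by simp [hlen], fun r hr => ?_⟩
    rcases List.mem_append.1 hr with hr | hr
    · exact hmem r hr
    · rw [List.mem_singleton.1 hr]
      exact ⟨(hadm H').1, gridPrice_mem i⟩

theorem Environment.input_mem (hadm : env.IsAdmissible M dlo dhi) {H : List (Round Θ)}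
    (hH : ∀ r ∈ H, (r.context, r.price) ∈ M.inputs) (s : ℕ) : env.input H s ∈ M.inputs := by
  unfold Environment.input
  rcases lt_or_ge s H.length with hs | hs
  · rw [List.getD_eq_getElem _ _ (by simpa using hs), List.getElem_map]
    exact hH _ (List.getElem_mem hs)
  -- The default pair, a context of the environment with price 0, is also a legitimate input, so
  -- membership holds at every index.
  · rw [List.getD_eq_default _ _ (by simpa using hs)]
    exact ⟨(hadm []).1, by simp⟩

/-- Links a history to a sequence indexed by ℕ, so that the oracle's guarantee for arbitrary
sequences applies along every adaptive run. -/
theorem Market.estimator_take {H : List (Round Θ)} {s : ℕ} (hs : s ≤ H.length) :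
    M.estimator O (H.take s) =
      O (pastPairs (env.input H) (fun s => M.production (env.input H s)) s) := by
  unfold Market.estimator pastPairs
  congr 1
  refine List.ext_getElem (by simp [hs]) fun j h1 h2 => ?_
  have hj : j < H.length := by
    simp only [List.length_map, List.length_take] at h1
    omega
  simp [Environment.input, hj]

theorem Market.production_mem (hM : M.IsRegular μ β xbar dlo dhi) (hμ : 0 < μ)
    {a : ((i : Fin n) → Θ i) × ℝ} (ha : a ∈ M.inputs) : M.production a ∈ Set.Icc 0 xbar :=
  ⟨totalSupply_nonneg hμ (hM.isCost _ ha.1) _, hM.production_le a ha⟩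

variable {F : Set (((i : Fin n) → Θ i) × ℝ → ℝ)} {T : ℕ} {Est ε : ℝ}

/-- Estimate and production both lie in [0, xbar]; the added 1 keeps the bound positive even if xbar
= 0. -/
theorem Market.sqError_le (hM : M.IsRegular μ β xbar dlo dhi) (hμ : 0 < μ)
    (hO : IsOnlineRegressionOracle M.inputs (Set.Icc 0 xbar) F O T Est)
    (hadm : env.IsAdmissible M dlo dhi) {H : List (Round Θ)}
    (hH : ∀ r ∈ H, (r.context, r.price) ∈ M.inputs) (hlen : H.length < T)
    {a : ((i : Fin n) → Θ i) × ℝ} (ha : a ∈ M.inputs) : M.sqError O H a ≤ xbar ^ 2 + 1 := by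
  have hin := Environment.input_mem hadm hH
  have h1 := hO.estimator_mapsTo (env.input H) (fun s => M.production (env.input H s))
    (fun t _ => hin t) (fun t _ => M.production_mem hM hμ (hin t)) H.length hlen ha
  rw [← Market.estimator_take (M := M) (O := O) le_rfl, List.take_length] at h1
  have h2 := M.production_mem hM hμ ha
  unfold Market.sqError
  nlinarith [mul_nonneg h1.1 h2.1, mul_nonneg h1.1 (sub_nonneg.2 h1.2),
    mul_nonneg h2.1 (sub_nonneg.2 h2.2), mul_nonneg (sub_nonneg.2 h1.2) (sub_nonneg.2 h2.2),
    h1.1, h1.2, h2.1, h2.2,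
    sq_nonneg (xbar - M.estimator O H a - M.production a)]

theorem Market.excess_append (B : ℝ) (H : List (Round Θ)) (i : Fin K) :
    M.excess O env K γ B (H.length + 1) (H ++ [env.nextRound K H i]) =
      M.excess O env K γ B H.length H + (M.meanSqError O env K γ H / (2 * B)
        - M.sqError O H ((env H).1, gridPrice K i) / B) := by
  unfold Market.excess
  rw [Finset.sum_range_succ]
  congr 1
  · refine Finset.sum_congr rfl fun s hs => ?_
    have hs' := Finset.mem_range.1 hs
    have : env.input (H ++ [env.nextRound K H i]) s = env.input H s := by
      simp [Environment.input, List.getElem?_append_left, hs']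
    rw [List.take_append_of_le_length hs'.le, this]
  · have : env.input (H ++ [env.nextRound K H i]) H.length = ((env H).1, gridPrice K i) := by
      simp [Environment.input, Environment.nextRound]
    rw [List.take_left, this]

/-- Conditionally on the past, the exponential of each increment of the excess has mean at most 1 by
`sum_mul_exp_le_one`. -/
theorem Market.tsum_exp_excess_le (hM : M.IsRegular μ β xbar dlo dhi) (hμ : 0 < μ)
    (hO : IsOnlineRegressionOracle M.inputs (Set.Icc 0 xbar) F O T Est)
    (hadm : env.IsAdmissible M dlo dhi) : ∀ t ≤ T, ∑' H, M.run O env K γ t H *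
      ENNReal.ofReal (Real.exp (M.excess O env K γ (xbar ^ 2 + 1) t H)) ≤ 1
  | 0, _ => by
    change ∑' H, PMF.pure [] H * _ ≤ (1 : ENNReal)
    rw [tsum_pure_mul]
    simp [Market.excess]
  | t + 1, ht => by
    refine le_trans ?_ (Market.tsum_exp_excess_le hM hμ hO hadm t (Nat.le_of_succ_le ht))
    rw [Market.run_succ, tsum_bind_mul]
    refine ENNReal.tsum_le_tsum fun H => ?_
    by_cases h0 : M.run O env K γ t H = 0
    · simp [h0]
    obtain ⟨rfl, hmem⟩ := Market.mem_support_run hadm ((PMF.mem_support_iff _ _).2 h0)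
    gcongr
    rw [tsum_map_mul, tsum_fintype]
    have hB : 0 < xbar ^ 2 + 1 := by positivity
    set E := M.excess O env K γ (xbar ^ 2 + 1) H.length H
    set p := M.priceDist O env K γ H with hp
    have hmgf := sum_mul_exp_le_one p (fun i => M.sqError O H ((env H).1, gridPrice K i)) hB
      (fun i => sq_nonneg _)
      (fun i => Market.sqError_le hM hμ hO hadm hmem ht ⟨(hadm H).1, gridPrice_mem i⟩)
    calc ∑ i, p i * ENNReal.ofReal (Real.exp (M.excess O env K γ (xbar ^ 2 + 1) (H.length + 1)
            (H ++ [env.nextRound K H i])))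
        = ∑ i, ENNReal.ofReal (Real.exp E * ((p i).toReal * Real.exp
            (M.meanSqError O env K γ H / (2 * (xbar ^ 2 + 1))
              - M.sqError O H ((env H).1, gridPrice K i) / (xbar ^ 2 + 1)))) := by
          refine Finset.sum_congr rfl fun i _ => ?_
          rw [Market.excess_append, Real.exp_add, mul_left_comm,
            ENNReal.ofReal_mul ENNReal.toReal_nonneg, ENNReal.ofReal_toReal (p.apply_ne_top i)]
      _ = ENNReal.ofReal (Real.exp E * ∑ i, (p i).toReal * Real.exp
            (M.meanSqError O env K γ H / (2 * (xbar ^ 2 + 1))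
              - M.sqError O H ((env H).1, gridPrice K i) / (xbar ^ 2 + 1))) := by
          rw [← ENNReal.ofReal_sum_of_nonneg fun i _ => by positivity, Finset.mul_sum]
      _ ≤ ENNReal.ofReal (Real.exp E) :=
          ENNReal.ofReal_le_ofReal (mul_le_of_le_one_right (Real.exp_pos _).le hmgf)

theorem IsOnlineRegressionOracle.sum_sq_le {A : Type w} {D : Set A} {R : Set ℝ}
    {F : Set (A → ℝ)} {O : Oracle A} (hO : IsOnlineRegressionOracle D R F O T Est) {g : A → ℝ}
    (hg : Set.MapsTo g D R) (hF : IsMisspecified D F ε g) {a : ℕ → A} (ha : ∀ t, a t ∈ D) :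
    ∑ t ∈ Finset.range T, (O (pastPairs a (fun s => g (a s)) t) (a t) - g (a t)) ^ 2
      ≤ Est + ε ^ 2 * T := by
  obtain ⟨f, hf, hfg⟩ := hF
  have h1 := hO.regret_le a (fun s => g (a s)) (fun t _ => ha t) (fun t _ => hg (ha t))
  have h2 : ⨅ f : F, ∑ t ∈ Finset.range T, (f.1 (a t) - g (a t)) ^ 2 ≤
      ∑ t ∈ Finset.range T, (f (a t) - g (a t)) ^ 2 :=
    ciInf_le (f := fun f : F => ∑ t ∈ Finset.range T, (f.1 (a t) - g (a t)) ^ 2)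
      ⟨0, Set.forall_mem_range.2 fun _ => Finset.sum_nonneg fun _ _ => sq_nonneg _⟩ ⟨f, hf⟩
  have h3 : ∑ t ∈ Finset.range T, (f (a t) - g (a t)) ^ 2 ≤ T * ε ^ 2 := by
    have : ∀ t ∈ Finset.range T, (f (a t) - g (a t)) ^ 2 ≤ ε ^ 2 := fun t _ =>
      sq_le_sq.2 ((hfg _ (ha t)).trans (le_abs_self ε))
    simpa using Finset.sum_le_card_nsmul _ _ _ this
  linarith

/-- A member of the class serves as its own ground truth, with ε = 0 and a constant input sequence:
the sum of squares is then at most Est. -/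
theorem IsOnlineRegressionOracle.est_nonneg {A : Type w} {D : Set A} {R : Set ℝ}
    {F : Set (A → ℝ)} {O : Oracle A} (hO : IsOnlineRegressionOracle D R F O T Est)
    (hF : F.Nonempty) (hD : D.Nonempty) : 0 ≤ Est := by
  obtain ⟨f, hf⟩ := hF
  obtain ⟨a, ha⟩ := hD
  have h := hO.sum_sq_le (ε := 0) (hO.class_mapsTo f hf) ⟨f, hf, by simp⟩ (a := fun _ => a)
    fun _ => ha
  simpa using (Finset.sum_nonneg fun _ _ => sq_nonneg _).trans h

end History

/-! ### From squared errors to the metrics -/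

section Regret

variable {M : Market Φ Θ} {O : Oracle (((i : Fin n) → Θ i) × ℝ)} {env : Environment Θ}
  {K : ℕ} [NeZero K] {γ : NNReal} {μ β xbar dlo dhi : ℝ}
  {F : Set (((i : Fin n) → Θ i) × ℝ → ℝ)} {T : ℕ} {Est ε : ℝ}

/-- The part of the regret analysis common to all metrics: the expected distance between
production and demand is controlled by the discretization, exploration and estimation errors. -/
theorem Market.sum_abs_production_sub_le (hM : M.IsRegular μ β xbar dlo dhi) (hμ : 0 < μ)
    (hdlo : 0 < dlo) (hK : 2 ≤ K) (hadm : env.IsAdmissible M dlo dhi) (hγ : 0 < (γ : ℝ))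
    (H : List (Round Θ)) :
    ∑ i, (M.priceDist O env K γ H i).toReal *
        |totalSupply (M.costs (env H).1) (gridPrice K i) - (env H).2|
      ≤ 4 * n / μ / K + 2 * K / γ + γ * M.meanSqError O env K γ H := by
  obtain ⟨hctx, hd⟩ := hadm H
  have hC := hM.isCost _ hctx
  obtain ⟨hp, hclear⟩ := eqPrice_spec hμ hC (hdlo.trans_le hd.1) (hM.price_normalized _ hctx _ hd)
  obtain ⟨k, hk⟩ := exists_abs_gridPrice_sub_le hK hp
  refine (sum_igw_mul_le hγ _ _ k).trans ?_
  have h1 : |totalSupply (M.costs (env H).1) (gridPrice K k) - (env H).2| ≤ 4 * n / μ / K := by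
    have h := abs_totalSupply_sub_le hμ hC (gridPrice K k) (eqPrice (M.costs (env H).1) (env H).2)
    rw [hclear] at h
    refine h.trans ((mul_le_mul_of_nonneg_left hk (by positivity)).trans (le_of_eq ?_))
    ring
  gcongr
  refine Finset.sum_le_sum fun i _ => mul_le_mul_of_nonneg_left ?_ ENNReal.toReal_nonneg
  -- Subtracting the demand and taking absolute values is 1-Lipschitz, so errors in the losses are
  -- at most errors in the production.
  refine (sq_le_sq.2 (abs_abs_sub_abs_le _ _)).trans (le_of_eq ?_)
  unfold Market.sqError Market.production
  ring

theorem Market.expectedMetric_le (hM : M.IsRegular μ β xbar dlo dhi) (hμ : 0 < μ)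
    (hdlo : 0 < dlo) (hK : 2 ≤ K) (hadm : env.IsAdmissible M dlo dhi) (hγ : 0 < (γ : ℝ))
    {loss : (Fin n → ℝ → ℝ) → ℝ → ℝ → ℝ} {A : ℝ} (hA : 0 ≤ A)
    (hloss : ∀ θ ∈ M.contexts, ∀ d ∈ Set.Icc dlo dhi, ∀ p ∈ Set.Icc (0 : ℝ) 1,
      loss (M.costs θ) d p ≤ A * |totalSupply (M.costs θ) p - d|) (H : List (Round Θ)) :
    M.expectedMetric O env K γ loss T H ≤ A * (4 * n / μ * (T / K) + 2 * (K * T / γ)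
      + γ * ∑ t ∈ Finset.range T, M.meanSqError O env K γ (H.take t)) := by
  unfold Market.expectedMetric
  calc _ ≤ ∑ t ∈ Finset.range T, A * (4 * n / μ / K + 2 * K / γ
        + γ * M.meanSqError O env K γ (H.take t)) := by
        refine Finset.sum_le_sum fun t _ => ?_
        refine le_trans ?_ (mul_le_mul_of_nonneg_left
          (M.sum_abs_production_sub_le hM hμ hdlo hK hadm hγ (H.take t)) hA)
        rw [Finset.mul_sum]
        refine Finset.sum_le_sum fun i _ => ?_
        rw [mul_left_comm]
        exact mul_le_mul_of_nonneg_left (hloss _ (hadm _).1 _ (hadm _).2 _ (gridPrice_mem i))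
          ENNReal.toReal_nonneg
    _ = _ := by
        rw [← Finset.mul_sum, Finset.sum_add_distrib, ← Finset.mul_sum, Finset.sum_const,
          Finset.card_range, nsmul_eq_mul]
        ring

theorem Market.IsRegular.loss_le (hM : M.IsRegular μ β xbar dlo dhi) (hμ : 0 < μ)
    (hdlo : 0 < dlo) {loss : (Fin n → ℝ → ℝ) → ℝ → ℝ → ℝ}
    (hl : loss = unmetDemand ∨ loss = paymentRegret ∨ loss = costRegret) :
    ∀ θ ∈ M.contexts, ∀ d ∈ Set.Icc dlo dhi, ∀ p ∈ Set.Icc (0 : ℝ) 1,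
      loss (M.costs θ) d p ≤ (1 + |β| * |dhi|) * |totalSupply (M.costs θ) p - d| := by
  intro θ hθ d hd p hp
  have hd0 : 0 < d := hdlo.trans_le hd.1
  have hC := hM.isCost θ hθ
  have hprice := hM.price_normalized θ hθ d hd
  have h1 : |totalSupply (M.costs θ) p - d|
      ≤ (1 + |β| * |dhi|) * |totalSupply (M.costs θ) p - d| :=
    le_mul_of_one_le_left (abs_nonneg _) (le_add_of_nonneg_right (by positivity))
  rcases hl with rfl | rfl | rfl
  · exact (unmetDemand_le d p).trans h1
  · refine (paymentRegret_le hμ hC hd0 hprice hp (hM.production_le (θ, p) ⟨hθ, hp⟩)).trans ?_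
    have := hd.2.trans (le_abs_self dhi)
    gcongr
  · exact (costRegret_le hμ hC hd0 hprice hp).trans h1

theorem Market.sum_meanSqError_le (hM : M.IsRegular μ β xbar dlo dhi) (hμ : 0 < μ)
    (hO : IsOnlineRegressionOracle M.inputs (Set.Icc 0 xbar) F O T Est)
    (hF : IsMisspecified M.inputs F ε M.production) (hadm : env.IsAdmissible M dlo dhi)
    {H : List (Round Θ)} (hlen : H.length = T) (hH : ∀ r ∈ H, (r.context, r.price) ∈ M.inputs)
    {L : ℝ} (hL : M.excess O env K γ (xbar ^ 2 + 1) T H ≤ L) :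
    ∑ t ∈ Finset.range T, M.meanSqError O env K γ (H.take t)
      ≤ 2 * (Est + ε ^ 2 * T) + 2 * (xbar ^ 2 + 1) * L := by
  have hB : 0 < xbar ^ 2 + 1 := by positivity
  have hsq : ∑ t ∈ Finset.range T, M.sqError O (H.take t) (env.input H t) ≤ Est + ε ^ 2 * T := by
    refine le_trans (le_of_eq (Finset.sum_congr rfl fun t ht => ?_))
      (hO.sum_sq_le (fun a ha => M.production_mem hM hμ ha) hF (Environment.input_mem hadm hH))
    rw [Market.sqError, Market.estimator_take (hlen ▸ (Finset.mem_range.1 ht).le)]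
  unfold Market.excess at hL
  rw [Finset.sum_sub_distrib, ← Finset.sum_div, ← Finset.sum_div] at hL
  -- Multiplying by 2B, with B = xbar² + 1, turns the excess into expected errors minus twice the
  -- realized ones.
  have h := mul_le_mul_of_nonneg_left hL (by positivity : 0 ≤ 2 * (xbar ^ 2 + 1))
  rw [mul_sub, mul_div_cancel₀ _ (by positivity), mul_assoc 2, mul_div_cancel₀ _ hB.ne'] at h
  linarith

end Regret

/-! ### Tuning of γ and the final bound -/

theorem sqrt_le_rate_terms {K T Est ε L : ℝ} (hK : 0 ≤ K) (hT : 0 ≤ T) (hE : 0 ≤ Est)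
    (hε : 0 ≤ ε) (hL : 0 ≤ L) :
    √(K * T * (Est + ε ^ 2 * T + L)) ≤ √(K * T * Est) + ε * √K * T + √(K * T * L) := by
  rw [Real.sqrt_le_iff]
  refine ⟨by positivity, ?_⟩
  have h1 := Real.sq_sqrt (show 0 ≤ K * T * Est by positivity)
  have h2 := Real.sq_sqrt (show 0 ≤ K * T * L by positivity)
  have h3 : (ε * √K * T) ^ 2 = K * T * (ε ^ 2 * T) := by
    rw [mul_pow, mul_pow, Real.sq_sqrt hK]; ring
  have hb : 0 ≤ ε * √K * T := by positivity
  have ha := Real.sqrt_nonneg (K * T * Est)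
  have hc := Real.sqrt_nonneg (K * T * L)
  nlinarith [mul_nonneg ha hb, mul_nonneg ha hc, mul_nonneg hb hc]

end EqPricing

theorem mainTheorem5 (n : ℕ) (μ β xbar dlo dhi : ℝ) (hμ : 0 < μ) (hdlo : 0 < dlo) :
    ∃ C : ℝ, 0 < C ∧
      ∀ (Φ : Fin n → Type u) (Θ : Fin n → Type v) (M : EqPricing.Market Φ Θ),
        M.IsRegular μ β xbar dlo dhi →
      ∀ (T K : ℕ) [NeZero K] (ε δ Est : ℝ),
        1 ≤ T → 2 ≤ K → 0 ≤ ε → 0 < δ → δ < 1 →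
      ∀ (F : Set (((i : Fin n) → Θ i) × ℝ → ℝ))
        (O : EqPricing.Oracle (((i : Fin n) → Θ i) × ℝ)),
        EqPricing.IsOnlineRegressionOracle M.inputs (Set.Icc 0 xbar) F O T Est →
        EqPricing.IsMisspecified M.inputs F ε M.production →
      ∀ env : EqPricing.Environment Θ, env.IsAdmissible M dlo dhi →
      ∀ γ : NNReal, (γ : ℝ) = √(K * T / (Est + ε ^ 2 * T + Real.log (1 / δ))) →
        ENNReal.ofReal (1 - δ) ≤ (M.run O env K γ T).toOuterMeasure
          {H | M.expectedMetric O env K γ EqPricing.unmetDemand T H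
                ≤ C * EqPricing.rate T K Est ε δ ∧
              M.expectedMetric O env K γ EqPricing.paymentRegret T H
                ≤ C * EqPricing.rate T K Est ε δ ∧
              M.expectedMetric O env K γ EqPricing.costRegret T H
                ≤ C * EqPricing.rate T K Est ε δ} := by
  set A : ℝ := 1 + |β| * |dhi| with hA
  set B : ℝ := xbar ^ 2 + 1 with hB
  have hA0 : 0 < A := by positivity
  have hB0 : 0 < B := by positivity
  -- A converts imbalance into any metric; the three summands come from discretization, exploration
  -- and estimation.
  refine ⟨A * (4 * n / μ + 2 + 2 * (1 + B)), by positivity, ?_⟩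
  intro Φ Θ M hM T K _ ε δ Est hT hK hε hδ hδ1 F O hO hF env hadm γ hγ
  set L := Real.log (1 / δ) with hL
  have hL0 : 0 < L := Real.log_pos (by rw [one_div]; exact (one_lt_inv₀ hδ).2 hδ1)
  have hE0 : 0 ≤ Est := hO.est_nonneg (hF.imp fun f hf => hf.1)
    ⟨((env []).1, 0), (hadm []).1, by simp⟩
  have hT0 : (0 : ℝ) < T := by exact_mod_cast hT
  have hK0 : (0 : ℝ) < K := by exact_mod_cast (zero_lt_two.trans_le hK)
  set S := Est + ε ^ 2 * T + L with hS
  have hS0 : 0 < S := by positivity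
  have hγ0 : 0 < (γ : ℝ) := by rw [hγ]; positivity
  set Q := √(K * T * S) with hQ
  -- The choice of γ makes the estimation term γ S and the exploration term K T / γ both equal to Q.
  have hγS : γ * S = Q := by
    rw [hγ, hQ, Real.sqrt_div (by positivity), Real.sqrt_mul (x := K * T) (by positivity),
      div_mul_eq_mul_div,
      mul_div_assoc, Real.div_sqrt]
  have hKγ : K * T / γ = Q := by
    rw [div_eq_iff hγ0.ne', ← hγS, mul_right_comm, ← sq, hγ, Real.sq_sqrt (by positivity)]
    field_simp
  have hQle : Q ≤ √(K * T * Est) + ε * √K * T + √(K * T * L) :=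
    EqPricing.sqrt_le_rate_terms hK0.le hT0.le hE0 hε hL0.le
  have hbound : ∀ loss, (loss = EqPricing.unmetDemand ∨ loss = EqPricing.paymentRegret ∨
      loss = EqPricing.costRegret) → ∀ H ∈ (M.run O env K γ T).support,
      M.excess O env K γ B T H ≤ L → M.expectedMetric O env K γ loss T H
        ≤ A * (4 * n / μ + 2 + 2 * (1 + B)) * EqPricing.rate T K Est ε δ := by
    intro loss hloss H hH hex
    obtain ⟨hlen, hmem⟩ := EqPricing.Market.mem_support_run hadm hH
    refine (EqPricing.Market.expectedMetric_le hM hμ hdlo hK hadm hγ0 hA0.le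
      (hM.loss_le hμ hdlo hloss) H).trans ?_
    have hsq := EqPricing.Market.sum_meanSqError_le hM hμ hO hF hadm hlen hmem hex
    have h1 : γ * ∑ t ∈ Finset.range T, M.meanSqError O env K γ (H.take t) ≤ 2 * (1 + B) * Q := by
      rw [← hγS, mul_left_comm]
      refine mul_le_mul_of_nonneg_left (hsq.trans ?_) hγ0.le
      have : 0 ≤ B * (Est + ε ^ 2 * T) := by positivity
      rw [hS]
      linarith
    have hrate : EqPricing.rate T K Est ε δ =
        √(K * T * Est) + ε * √K * T + T / K + √(K * T * L) := rfl
    rw [mul_assoc, hKγ, hrate]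
    refine mul_le_mul_of_nonneg_left ?_ hA0.le
    have hQ0 : 0 ≤ Q := Real.sqrt_nonneg _
    have hTK : 0 ≤ (T : ℝ) / K := by positivity
    have hn : 0 ≤ 4 * n / μ := by positivity
    calc _ ≤ (4 * n / μ + 2 + 2 * (1 + B)) * (Q + T / K) := by
          have : 0 ≤ 4 * n / μ * Q := by positivity
          have : 0 ≤ (2 + 2 * (1 + B)) * ((T : ℝ) / K) := by positivity
          linarith
      _ ≤ _ := mul_le_mul_of_nonneg_left (by linarith) (by positivity)
  refine EqPricing.ofReal_one_sub_le_toOuterMeasure _ _ hδ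
    (EqPricing.Market.tsum_exp_excess_le hM hμ hO hadm T le_rfl) fun H hH hnot => ?_
  -- If any of the three bounds fails, the excess is above log(1/δ), so δ times its exponential is
  -- at least 1, as Markov's inequality requires.
  have hex : L < M.excess O env K γ B T H := by
    by_contra! hle
    exact hnot ⟨hbound _ (.inl rfl) H hH hle, hbound _ (.inr (.inl rfl)) H hH hle,
      hbound _ (.inr (.inr rfl)) H hH hle⟩
  rw [← ENNReal.ofReal_mul hδ.le, ENNReal.one_le_ofReal]
  have h1 : 1 / δ ≤ Real.exp (M.excess O env K γ B T H) := by
    rw [← Real.exp_log (one_div_pos.2 hδ)]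
    exact Real.exp_le_exp.2 hex.le
  calc (1 : ℝ) = δ * (1 / δ) := by field_simp
    _ ≤ _ := mul_le_mul_of_nonneg_left h1 hδ.le
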